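/- There are a function $R:\mathbb{N}\to\mathbb{N}$ with $R(m)=O(\log m)$ as $m\to\infty$, a polynomial $p$ with natural-number coefficients, and two deterministic parallel algorithms $A_{\min}$ and $A_{\max}$, such that the following holds for every $m\in\mathbb{N}$, every weight function $w:[m]\to\mathbb{R}$ and every graphic matroid $M$ with ground set $[m]$. Given $m$, $w$ and access to the independence oracle of $M$ (which tells, for a queried set $S\subseteq[m]$, whether $S$ is independent in $M$), each of the two algorithms uses at most $R(m)$ adaptive rounds and makes at most $p(m)$ non-adaptive queries in each round; $A_{\min}$ returns a minimum-weight and $A_{\max}$ a maximum-weight spanning forest of $M$. Here a matroid is graphic if its ground set is the edge set of a graph (loops and parallel edges allowed) and a set of edges is independent exactly when it contains no cycle. A spanning forest is a basis of $M$, and its weight is the sum of the weights of its elements. A deterministic parallel algorithm is a (possibly non-uniform) family of decision trees, one for each $m$ and $w$: each internal node is one round and submits finitely many subsets of $[m]$ to the oracle simultaneously, its branches are labelled by the possible vectors of answers, and each leaf is labelled by the returned subset of $[m]$. -/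

import Mathlib

/-- `C` is the edge set of a cycle of the (multi)graph `G`: the edges `e 0, …, e n` are distinct,
the vertices `v 0, …, v n` are distinct, and `e i` joins `v i` to `v (i + 1)`, indices being
cyclic modulo `n + 1`. A loop is a cycle of length one, and two parallel edges form a cycle of
length two. -/
def Graph.IsCycleEdgeSet {V E : Type*} (G : Graph V E) (C : Set E) : Prop :=
  ∃ (n : ℕ) (v : Fin (n + 1) → V) (e : Fin (n + 1) → E),
    Function.Injective v ∧ Function.Injective e ∧
      (∀ i, G.IsLink (e i) (v i) (v (i + 1))) ∧ C = Set.range e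

/-- A matroid is graphic if it is the cycle matroid of a graph: its ground set is the edge set
of a (multi)graph, and a set of edges is independent iff no cycle is contained in it. -/
def Matroid.IsGraphic {E : Type*} (M : Matroid E) : Prop :=
  ∃ (V : Type) (G : Graph V E), M.E = G.edgeSet ∧
    ∀ S ⊆ M.E, M.Indep S ↔ ¬ ∃ C ⊆ S, G.IsCycleEdgeSet C

open scoped Classical in
/-- The independence oracle: given a set of elements, tell whether it is independent. -/
noncomputable def Matroid.indepOracle {m : ℕ} (M : Matroid (Fin m)) : Finset (Fin m) → Bool :=
  fun S => decide (M.Indep (S : Set (Fin m)))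

/-- Deterministic parallel decision trees over the ground set `Fin m`. A query node is one
adaptive round: the `q` sets `B 0, …, B (q - 1)` are submitted to the oracle simultaneously, and
the tree branches on the vector of answers. A leaf holds the output. -/
inductive ParallelTree (m : ℕ) : Type
  | leaf (F : Finset (Fin m)) : ParallelTree m
  | query (q : ℕ) (B : Fin q → Finset (Fin m)) (next : (Fin q → Bool) → ParallelTree m) :
      ParallelTree m

namespace ParallelTree

variable {m : ℕ}

/-- The output of the tree when the oracle is `O`. -/
def output (O : Finset (Fin m) → Bool) : ParallelTree m → Finset (Fin m)
  | leaf F => F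
  | query _ B next => output O (next fun i => O (B i))

/-- The number of adaptive rounds used when the oracle is `O`. -/
def rounds (O : Finset (Fin m) → Bool) : ParallelTree m → ℕ
  | leaf _ => 0
  | query _ B next => rounds O (next fun i => O (B i)) + 1

/-- The largest number of queries made in a single round when the oracle is `O`. -/
def maxQueries (O : Finset (Fin m) → Bool) : ParallelTree m → ℕ
  | leaf _ => 0
  | query q B next => max q (maxQueries O (next fun i => O (B i)))

end ParallelTree

/-- `F` is a basis of `M` (a spanning forest if `M` is graphic) of minimum total weight. -/
def Matroid.IsMinWeightBase {E : Type*} (M : Matroid E) (w : E → ℝ) (F : Finset E) : Prop :=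
  M.IsBase (F : Set E) ∧
    ∀ F' : Finset E, M.IsBase (F' : Set E) → ∑ e ∈ F, w e ≤ ∑ e ∈ F', w e

/-- `F` is a basis of `M` (a spanning forest if `M` is graphic) of maximum total weight. -/
def Matroid.IsMaxWeightBase {E : Type*} (M : Matroid E) (w : E → ℝ) (F : Finset E) : Prop :=
  M.IsBase (F : Set E) ∧
    ∀ F' : Finset E, M.IsBase (F' : Set E) → ∑ e ∈ F', w e ≤ ∑ e ∈ F, w e

/-! Order the elements by weight. Elements spanned by earlier ones may be deleted simultaneously,
and once no cycle remains the survivors form a minimum-weight base; the maximum case follows by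
negating `w`. Round `i`, with `h = 2 ^ i`, turns the absence of cycles of length at most `4h`
(nothing is needed for `h = 1`) into the absence of cycles of length at most `8h`, so `Nat.log 2 m +
1` rounds suffice.

Let `Y` be the remaining elements before `e`, suppose `e` closes a cycle of length at most `8h` with
`Y`, and let `P` be a shortest such cycle without `e`. Let `B` be the number of pairs of vertices,
and sample a set `S` with density `p`, where `p ^ h = 1 / (2B)`. Then `P ⊆ S` with probability at
least `(2B)⁻⁸`. Given this, `S ∩ Y` is a forest with probability at least 1/2: for `h > 1` a cycle
in `Y` has more than `2h` edges outside `P`, so touring it passes through a path with exactly `h`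
edges outside `P`; the ends of the path determine those edges, so at most `B` sets of size `h` must
be avoided (`exists_small_obstructions`, `exists_likely_spanning_path`). On success `S ∩ Y` is
independent and adding `e` makes it dependent, so two queries expose `e`.

The success probability is inverse polynomial and there are only exponentially many triples (graph,
`Y`, `P`), so one polynomial family of samples, independent of the matroid, serves them all
(`exists_hitting_finset`, `exists_detecting_family`). -/

/-! ### Random subsets and the union bound. -/

/-- The probability of `S` when each element is chosen independently with probability `p`. -/
noncomputable def bernoulliWeight {E : Type*} [Fintype E] (p : ℝ) (S : Finset E) : ℝ :=
  p ^ S.card * (1 - p) ^ (Fintype.card E - S.card)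

theorem bernoulliWeight_nonneg {E : Type*} [Fintype E] {p : ℝ} (h0 : 0 ≤ p) (h1 : p ≤ 1)
    (S : Finset E) : 0 ≤ bernoulliWeight p S :=
  mul_nonneg (pow_nonneg h0 _) (pow_nonneg (sub_nonneg.2 h1) _)

theorem sum_bernoulliWeight_superset {E : Type*} [Fintype E] [DecidableEq E] (p : ℝ)
    (T : Finset E) :
    ∑ S with T ⊆ S, bernoulliWeight p S = p ^ T.card := by
  have h1 : (Finset.univ.filter fun S : Finset E => T ⊆ S) = Finset.Icc T Finset.univ := by
    ext S; simp
  rw [h1, Finset.Icc_eq_image_powerset (Finset.subset_univ T), Finset.sum_image]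
  · have h2 := Finset.sum_pow_mul_eq_add_pow p (1 - p) (Finset.univ \ T)
    rw [add_sub_cancel, one_pow] at h2
    rw [← mul_one (p ^ T.card), ← h2, Finset.mul_sum]
    refine Finset.sum_congr rfl fun S hS => ?_
    have hd : Disjoint T S :=
      Finset.disjoint_of_subset_right (Finset.mem_powerset.1 hS) Finset.disjoint_sdiff
    have hc : (Finset.univ \ T).card = Fintype.card E - T.card := by
      rw [Finset.card_sdiff_of_subset (Finset.subset_univ T), Finset.card_univ]
    rw [bernoulliWeight, Finset.card_union_of_disjoint hd, hc, pow_add, Nat.sub_add_eq, mul_assoc]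
  · intro S hS S' hS' h
    have hd := Finset.disjoint_of_subset_right (Finset.mem_powerset.1 hS)
      (Finset.disjoint_sdiff (s := T) (t := Finset.univ))
    have hd' := Finset.disjoint_of_subset_right (Finset.mem_powerset.1 hS')
      (Finset.disjoint_sdiff (s := T) (t := Finset.univ))
    have := congrArg (fun U => U \ T) h
    simpa [Finset.union_sdiff_cancel_left hd, Finset.union_sdiff_cancel_left hd'] using this

theorem sum_bernoulliWeight {E : Type*} [Fintype E] [DecidableEq E] (p : ℝ) :
    ∑ S : Finset E, bernoulliWeight p S = 1 := by
  simpa using sum_bernoulliWeight_superset p (∅ : Finset E)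

open scoped Classical in
/-- A random set contains `P` and avoids containing any member of a small family of sets
disjoint from `P` with probability at least half of the probability that it contains `P`. -/
theorem half_pow_le_sum_bernoulliWeight {E : Type*} [Fintype E] [DecidableEq E] {p : ℝ}
    (h0 : 0 ≤ p) (h1 : p ≤ 1) (P : Finset E) (𝒬 : Finset (Finset E)) (h : ℕ)
    (hcard : ∀ Q ∈ 𝒬, Q.card = h) (hdisj : ∀ Q ∈ 𝒬, Disjoint P Q)
    (hsmall : 𝒬.card * p ^ h ≤ 1 / 2) :
    p ^ P.card / 2 ≤ ∑ S with P ⊆ S ∧ ∀ Q ∈ 𝒬, ¬ Q ⊆ S, bernoulliWeight p S := by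
  -- Union bound: a set containing `P` that is not good contains some `P ∪ Q`.
  have key : ∑ S with P ⊆ S, bernoulliWeight p S ≤
      ∑ S with P ⊆ S ∧ ∀ Q ∈ 𝒬, ¬ Q ⊆ S, bernoulliWeight p S +
        ∑ Q ∈ 𝒬, ∑ S with P ∪ Q ⊆ S, bernoulliWeight p S := by
    simp only [Finset.sum_filter]
    rw [Finset.sum_comm, ← Finset.sum_add_distrib]
    refine Finset.sum_le_sum fun S _ => ?_
    have hw := bernoulliWeight_nonneg h0 h1 S
    have hs : 0 ≤ ∑ Q ∈ 𝒬, if P ∪ Q ⊆ S then bernoulliWeight p S else 0 :=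
      Finset.sum_nonneg fun Q _ => by split_ifs <;> simp [hw]
    by_cases hP : P ⊆ S
    · by_cases hQ : ∀ Q ∈ 𝒬, ¬ Q ⊆ S
      · rw [if_pos hP, if_pos ⟨hP, hQ⟩]; linarith
      · push Not at hQ
        obtain ⟨Q, hQ, hQS⟩ := hQ
        have := Finset.single_le_sum (f := fun Q => if P ∪ Q ⊆ S then bernoulliWeight p S else 0)
          (fun Q _ => by split_ifs <;> simp [hw]) hQ
        simp only [if_pos (Finset.union_subset hP hQS)] at this
        rw [if_pos hP]
        split_ifs <;> linarith
    · rw [if_neg hP, if_neg (fun h => hP h.1)]; linarith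
  rw [sum_bernoulliWeight_superset] at key
  have h2 : ∑ Q ∈ 𝒬, ∑ S with P ∪ Q ⊆ S, bernoulliWeight p S = 𝒬.card * p ^ h * p ^ P.card := by
    rw [Finset.sum_congr rfl (g := fun _ => p ^ h * p ^ P.card)]
    · simp [mul_assoc]
    · intro Q hQ
      rw [sum_bernoulliWeight_superset, Finset.card_union_of_disjoint (hdisj Q hQ), hcard Q hQ,
        pow_add, mul_comm]
  rw [h2] at key
  nlinarith [pow_nonneg h0 P.card]

/-! ### Derandomization by greedy hitting sets. -/

open scoped Classical in
/-- Greedy hitting sets: `N` sample points hit all but a `(1 - 1 / K) ^ N` fraction of the events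
of probability at least `1 / K`. -/
theorem exists_finset_card_unhit_le {Ω X : Type*} [Fintype Ω] [Fintype X] (μ : Ω → ℝ)
    (hμ : ∀ ω, 0 ≤ μ ω) (hsum : ∑ ω, μ ω = 1) (good : X → Ω → Prop) (c : ℝ)
    (hc1 : c ≤ 1) (N : ℕ) :
    ∃ F : Finset Ω, F.card ≤ N ∧
      ((Finset.univ.filter fun x : X =>
        c ≤ (∑ ω with good x ω, μ ω) ∧ ∀ ω ∈ F, ¬ good x ω).card : ℝ) ≤
        (1 - c) ^ N * Fintype.card X := by
  induction N with
  | zero =>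
    refine ⟨∅, le_rfl, ?_⟩
    rw [pow_zero, one_mul]
    exact_mod_cast Finset.card_le_univ _
  | succ N ih =>
    obtain ⟨F, hF, hU⟩ := ih
    set U := Finset.univ.filter fun x : X =>
        c ≤ (∑ ω with good x ω, μ ω) ∧ ∀ ω ∈ F, ¬ good x ω with hUdef
    -- Averaging: each unhit event has mass at least `c`, so some point hits a fraction `c` of them.
    obtain ⟨ω, hω⟩ : ∃ ω, c * U.card ≤ (U.filter fun x => good x ω).card := by
      by_contra! hcon
      have h1 : c * U.card ≤ ∑ x ∈ U, ∑ ω with good x ω, μ ω := by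
        rw [mul_comm, ← nsmul_eq_mul, ← Finset.sum_const]
        exact Finset.sum_le_sum fun x hx => (Finset.mem_filter.1 hx).2.1
      have h2 : ∑ x ∈ U, ∑ ω with good x ω, μ ω =
          ∑ ω, μ ω * (U.filter fun x => good x ω).card := by
        simp only [Finset.sum_filter]
        rw [Finset.sum_comm]
        refine Finset.sum_congr rfl fun ω _ => ?_
        rw [← Finset.sum_filter, Finset.sum_const, nsmul_eq_mul, mul_comm]
      have h3 : ∑ ω, μ ω * (U.filter fun x => good x ω).card < ∑ ω, μ ω * (c * U.card) := by
        obtain ⟨ω, hω⟩ : ∃ ω, 0 < μ ω := by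
          by_contra! hle
          have : ∑ ω, μ ω ≤ 0 := Finset.sum_nonpos fun ω _ => hle ω
          linarith
        exact Finset.sum_lt_sum (fun ω _ => mul_le_mul_of_nonneg_left (hcon ω).le (hμ ω))
          ⟨ω, Finset.mem_univ _, mul_lt_mul_of_pos_left (hcon ω) hω⟩
      rw [← Finset.sum_mul, hsum, one_mul] at h3
      linarith
    refine ⟨insert ω F, (Finset.card_insert_le _ _).trans (by omega), ?_⟩
    have h4 : (Finset.univ.filter fun x : X =>
        c ≤ (∑ ω with good x ω, μ ω) ∧ ∀ ω' ∈ insert ω F, ¬ good x ω') =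
        U.filter fun x => ¬ good x ω := by
      ext x
      simp only [hUdef, Finset.mem_filter, Finset.mem_univ, true_and, Finset.mem_insert,
        forall_eq_or_imp]
      tauto
    rw [h4]
    have h5 : ((U.filter fun x => good x ω).card : ℝ) + (U.filter fun x => ¬ good x ω).card =
        U.card := by
      exact_mod_cast Finset.card_filter_add_card_filter_not (s := U) (fun x => good x ω)
    calc ((U.filter fun x => ¬ good x ω).card : ℝ) ≤ (1 - c) * U.card := by linarith
      _ ≤ (1 - c) * ((1 - c) ^ N * Fintype.card X) :=
        mul_le_mul_of_nonneg_left hU (sub_nonneg.2 hc1)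
      _ = _ := by ring

-- After `K * n` points the unhit fraction is at most `2⁻ⁿ`, which leaves less than one of fewer
-- than `2 ^ n` events.
open scoped Classical in
theorem exists_hitting_finset {Ω X : Type*} [Fintype Ω] [Fintype X] (μ : Ω → ℝ)
    (hμ : ∀ ω, 0 ≤ μ ω) (hsum : ∑ ω, μ ω = 1) (good : X → Ω → Prop) (K n : ℕ) (hK : 0 < K)
    (hX : Fintype.card X < 2 ^ n) :
    ∃ F : Finset Ω, F.card ≤ K * n ∧
      ∀ x, 1 / (K : ℝ) ≤ ∑ ω with good x ω, μ ω → ∃ ω ∈ F, good x ω := by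
  have hK1 : (1 : ℝ) ≤ K := by exact_mod_cast hK
  have hc1 : 1 / (K : ℝ) ≤ 1 := by rw [div_le_one (by linarith)]; exact hK1
  obtain ⟨F, hF, hU⟩ := exists_finset_card_unhit_le μ hμ hsum good (1 / (K : ℝ)) hc1 (K * n)
  refine ⟨F, hF, fun x hx => ?_⟩
  by_contra! hcon
  have h1 : (1 - 1 / (K : ℝ)) ^ K ≤ 1 / 2 := by
    have h2 : 1 - 1 / (K : ℝ) ≤ Real.exp (-(1 / K)) := by
      have := Real.add_one_le_exp (-(1 / (K : ℝ))); linarith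
    calc (1 - 1 / (K : ℝ)) ^ K ≤ Real.exp (-(1 / K)) ^ K :=
          pow_le_pow_left₀ (sub_nonneg.2 hc1) h2 _
      _ = Real.exp (-1) := by
          rw [← Real.exp_nat_mul]; congr 1; field_simp
      _ ≤ 1 / 2 := by
          rw [Real.exp_neg, ← one_div]
          exact one_div_le_one_div_of_le (by norm_num) (by linarith [Real.add_one_le_exp (1 : ℝ)])
  have h3 : (1 - 1 / (K : ℝ)) ^ (K * n) * Fintype.card X < 1 := by
    rw [pow_mul]
    calc ((1 - 1 / (K : ℝ)) ^ K) ^ n * Fintype.card X ≤ (1 / 2) ^ n * Fintype.card X :=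
          mul_le_mul_of_nonneg_right
            (pow_le_pow_left₀ (pow_nonneg (sub_nonneg.2 hc1) _) h1 _) (Nat.cast_nonneg _)
      _ < (1 / 2) ^ n * 2 ^ n :=
          mul_lt_mul_of_pos_left (by exact_mod_cast hX) (by positivity)
      _ = 1 := by rw [← mul_pow]; norm_num
  have h4 : (1 : ℝ) ≤ (Finset.univ.filter fun x : X =>
        1 / (K : ℝ) ≤ (∑ ω with good x ω, μ ω) ∧ ∀ ω ∈ F, ¬ good x ω).card := by
    rw [Nat.one_le_cast, Nat.one_le_iff_ne_zero, Finset.card_ne_zero]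
    exact ⟨x, Finset.mem_filter.2 ⟨Finset.mem_univ _, hx, hcon⟩⟩
  linarith

/-! ### Boundaries modulo two and the obstructions to being a forest. -/

/-- The boundary modulo two of a set of edges with endpoints given by `x`. -/
def edgeBoundary {E V : Type*} [DecidableEq V] (x : E → V × V) (T : Finset E) : V → ZMod 2 :=
  ∑ e ∈ T, (Pi.single (x e).1 1 + Pi.single (x e).2 1)

/-- No nonempty subset of `S` has zero boundary. -/
def EvenFree {E V : Type*} [DecidableEq V] (x : E → V × V) (S : Finset E) : Prop :=
  ∀ T ⊆ S, edgeBoundary x T = 0 → T = ∅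

/-- Every set that is not `EvenFree` contains a nonempty set with zero boundary whose edges can be
added one at a time such that each intermediate boundary is that of a path. -/
def HasTraversals {E V : Type*} [DecidableEq E] [DecidableEq V] (x : E → V × V) : Prop :=
  ∀ S, ¬ EvenFree x S → ∃ (n : ℕ) (D : ℕ → Finset E), D 0 = ∅ ∧
    (∀ k, (D (k + 1) \ D k).card ≤ 1) ∧ (∀ k, D k ⊆ S) ∧
    (∀ k ≤ n, ∃ a b, edgeBoundary x (D k) = Pi.single a 1 + Pi.single b 1) ∧
    edgeBoundary x (D n) = 0 ∧ (D n).Nonempty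

theorem ZMod.two_fun_add_self {V : Type*} (f : V → ZMod 2) : f + f = 0 := by
  ext v; exact CharTwo.add_self_eq_zero _

/-- Common edges cancel modulo two. This additivity lets cycles and paths be summed in the
minimality and uniqueness arguments below. -/
theorem edgeBoundary_symmDiff {E V : Type*} [DecidableEq E] [DecidableEq V] (x : E → V × V)
    (S T : Finset E) :
    edgeBoundary x (symmDiff S T) = edgeBoundary x S + edgeBoundary x T := by
  have h1 := Finset.sum_inter_add_sum_sdiff S T
    (fun e => (Pi.single (x e).1 1 + Pi.single (x e).2 1 : V → ZMod 2))
  have h2 := Finset.sum_inter_add_sum_sdiff T S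
    (fun e => (Pi.single (x e).1 1 + Pi.single (x e).2 1 : V → ZMod 2))
  unfold edgeBoundary
  rw [← h1, ← h2, Finset.inter_comm T S, symmDiff_def, Finset.sup_eq_union,
    Finset.sum_union disjoint_sdiff_sdiff]
  rw [add_add_add_comm, ZMod.two_fun_add_self, zero_add]

/-- Discrete intermediate value: the count outside `P` starts at zero and rises by at most one per
step. -/
theorem exists_card_sdiff_eq {E : Type*} [DecidableEq E] (D : ℕ → Finset E) (P : Finset E)
    (h0 : D 0 = ∅) (hstep : ∀ k, (D (k + 1) \ D k).card ≤ 1) (h n : ℕ)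
    (hn : h ≤ (D n \ P).card) : ∃ k ≤ n, (D k \ P).card = h := by
  induction n with
  | zero => exact ⟨0, le_rfl, by simp_all⟩
  | succ n ih =>
    by_cases hle : h ≤ (D n \ P).card
    · obtain ⟨k, hk, hk'⟩ := ih hle
      exact ⟨k, by omega, hk'⟩
    · have h1 : (D (n + 1) \ P) ⊆ (D n \ P) ∪ (D (n + 1) \ D n) := by
        intro e; simp only [Finset.mem_sdiff, Finset.mem_union]; tauto
      have h2 := (Finset.card_le_card h1).trans (Finset.card_union_le _ _)
      have h3 := hstep n
      exact ⟨n + 1, le_rfl, by omega⟩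

open scoped Classical in
/-- If every nonempty set `T ⊆ Y` with zero boundary has many elements outside `P`, then a small
family of sets of size `h` meets the following: a subset of `Y` that contains no member of it
together with `P` is `EvenFree`. -/
theorem exists_small_obstructions {E V : Type*} [Fintype E] [DecidableEq E] [Fintype V] [DecidableEq V]
    [Nonempty V]
    (x : E → V × V) (hx : HasTraversals x) (hE : Fintype.card E ≤ Fintype.card (V × V))
    (P Y : Finset E) (h : ℕ)
    (hg : ∀ T ⊆ Y, edgeBoundary x T = 0 → T.Nonempty →
      2 * h < (T \ P).card ∨ h = 1 ∧ 1 ≤ (T \ P).card) :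
    ∃ 𝒬 : Finset (Finset E), 𝒬.card ≤ Fintype.card (V × V) ∧ (∀ Q ∈ 𝒬, Q.card = h) ∧
      (∀ Q ∈ 𝒬, Disjoint P Q) ∧
      ∀ S, (∀ Q ∈ 𝒬, ¬ Q ⊆ S) → EvenFree x (S ∩ Y) := by
  -- For `h = 1` no girth is available, but all singletons outside `P` are few enough.
  by_cases h1 : h = 1
  · subst h1
    refine ⟨(Finset.powersetCard 1 (Finset.univ \ P)), ?_, ?_, ?_, ?_⟩
    · rw [Finset.card_powersetCard, Nat.choose_one_right]
      exact (Finset.card_le_univ _).trans hE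
    · intro Q hQ; exact (Finset.mem_powersetCard.1 hQ).2
    · intro Q hQ
      exact Finset.disjoint_of_subset_right (Finset.mem_powersetCard.1 hQ).1 Finset.disjoint_sdiff
    · intro S hS T hT hT0
      by_contra hne
      have := hg T (hT.trans Finset.inter_subset_right) hT0 (Finset.nonempty_iff_ne_empty.2 hne)
      obtain ⟨e, he⟩ : (T \ P).Nonempty := Finset.card_pos.1 (by omega)
      rw [Finset.mem_sdiff] at he
      refine hS {e} ?_ ?_
      · simp [Finset.mem_powersetCard, he.2]
      · simpa using Finset.mem_of_mem_inter_left (hT he.1)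
  -- The parts outside `P` of sets with the boundary of a path, when they have size `h`.
  · set 𝒬 : Finset (Finset E) := Finset.univ.filter fun Q => Q.card = h ∧ Q ⊆ Y \ P ∧
      ∃ U ⊆ Y, U \ P = Q ∧ ∃ ab : V × V, edgeBoundary x U = Pi.single ab.1 1 + Pi.single ab.2 1
      with h𝒬
    have hmem : ∀ Q ∈ 𝒬, Q.card = h ∧ Q ⊆ Y \ P ∧ ∃ U ⊆ Y, U \ P = Q ∧
        ∃ ab : V × V, edgeBoundary x U = Pi.single ab.1 1 + Pi.single ab.2 1 :=
      fun Q hQ => (Finset.mem_filter.1 hQ).2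
    refine ⟨𝒬, ?_, fun Q hQ => (hmem Q hQ).1, fun Q hQ =>
      Finset.disjoint_of_subset_right (hmem Q hQ).2.1 Finset.disjoint_sdiff, ?_⟩
    · choose! hc hY U hU hUQ ab hab using hmem
      refine Finset.card_le_card_of_injOn ab (fun _ _ => Finset.mem_univ _) ?_
      intro Q hQ Q' hQ' heq
      by_contra hne
      -- Two different members with the same ends would sum to a nonempty set of zero boundary with
      -- at most `2h` elements outside `P`.
      have hz : edgeBoundary x (symmDiff (U Q) (U Q')) = 0 := by
        rw [edgeBoundary_symmDiff, hab Q hQ, hab Q' hQ', heq, ZMod.two_fun_add_self]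
      have hsd : symmDiff (U Q) (U Q') \ P = symmDiff Q Q' := by
        conv_rhs => rw [← hUQ Q hQ, ← hUQ Q' hQ']
        ext e; simp only [Finset.mem_sdiff, Finset.mem_symmDiff]; tauto
      have hsub : symmDiff (U Q) (U Q') ⊆ Y := by
        intro e he
        rcases Finset.mem_symmDiff.1 he with h | h
        exacts [hU Q hQ h.1, hU Q' hQ' h.1]
      have hne' : (symmDiff Q Q').Nonempty :=
        Finset.nonempty_iff_ne_empty.2 fun h => hne (symmDiff_eq_bot.1 h)
      have hne'' : (symmDiff (U Q) (U Q')).Nonempty := by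
        rw [← hsd] at hne'; exact hne'.mono Finset.sdiff_subset
      have hcard : (symmDiff Q Q').card ≤ Q.card + Q'.card := by
        refine (Finset.card_le_card (t := Q ∪ Q') ?_).trans (Finset.card_union_le _ _)
        intro e; simp only [Finset.mem_symmDiff, Finset.mem_union]; tauto
      have := hg _ hsub hz hne''
      rw [hsd] at this
      have a1 := hc Q hQ
      have a2 := hc Q' hQ'
      omega
    · intro S hS
      by_contra hcon
      obtain ⟨n, D, hD0, hstep, hDS, hpath, hDn, hne⟩ := hx _ hcon
      have hDY : ∀ k, D k ⊆ Y := fun k => (hDS k).trans Finset.inter_subset_right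
      obtain ⟨k, hk, hkc⟩ := exists_card_sdiff_eq D P hD0 hstep h n
        (by have := hg (D n) (hDY n) hDn hne; omega)
      obtain ⟨a, b, hab⟩ := hpath k hk
      refine hS (D k \ P) ?_ (Finset.sdiff_subset.trans ((hDS k).trans Finset.inter_subset_left))
      exact Finset.mem_filter.2 ⟨Finset.mem_univ _, hkc, Finset.sdiff_subset_sdiff (hDY k) le_rfl,
        D k, hDY k, rfl, (a, b), hab⟩

open scoped Classical in
/-- If `e` closes a cycle of length at most `8 * h` with `Y` and there are no cycles of length
at most `4 * h`, then a random subset of `Y` is a forest that spans `e` with substantial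
probability. -/
theorem exists_likely_spanning_path {E V : Type*} [Fintype E] [DecidableEq E] [Fintype V] [DecidableEq V]
    [Nonempty V]
    (x : E → V × V) (hx : HasTraversals x) (hE : Fintype.card E ≤ Fintype.card (V × V))
    (Y : Finset E) (e : E) (he : e ∉ Y) (h : ℕ)
    (hg : ∀ T ⊆ Y, edgeBoundary x T = 0 → T.Nonempty → 4 * h < T.card ∨ h = 1)
    (hT : ∃ T ⊆ insert e Y, e ∈ T ∧ edgeBoundary x T = 0 ∧ T.card ≤ 8 * h)
    (p : ℝ) (hp0 : 0 < p) (hp1 : p ≤ 1) (hp : p ^ h = 1 / (2 * Fintype.card (V × V) : ℕ)) :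
    ∃ P ⊆ Y, edgeBoundary x (insert e P) = 0 ∧
      1 / ((2 * (2 * Fintype.card (V × V)) ^ 8 : ℕ) : ℝ) ≤
        ∑ S with P ⊆ S ∧ EvenFree x (S ∩ Y), bernoulliWeight p S := by
  set B := Fintype.card (V × V) with hB
  have hBpos : 0 < B := Fintype.card_pos
  set C := Finset.univ.filter fun T : Finset E => T ⊆ insert e Y ∧ e ∈ T ∧ edgeBoundary x T = 0
    with hC
  obtain ⟨T₀, hT₀, heT₀, hT₀0, hT₀c⟩ := hT
  obtain ⟨T, hTC, hmin⟩ := Finset.exists_min_image C Finset.card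
    ⟨T₀, Finset.mem_filter.2 ⟨Finset.mem_univ _, hT₀, heT₀, hT₀0⟩⟩
  have hTc : T.card ≤ 8 * h :=
    (hmin T₀ (Finset.mem_filter.2 ⟨Finset.mem_univ _, hT₀, heT₀, hT₀0⟩)).trans hT₀c
  obtain ⟨hTY, heT, hT0⟩ := (Finset.mem_filter.1 hTC).2
  have hPY : T.erase e ⊆ Y := by
    intro f hf
    rcases Finset.mem_insert.1 (hTY (Finset.mem_of_mem_erase hf)) with h | h
    exacts [absurd h (Finset.ne_of_mem_erase hf), h]
  -- Adding `T'` to the shortest `T` gives another competitor containing `e`, so at most half of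
  -- `T'` lies in `T`.
  have hbig : ∀ T' ⊆ Y, edgeBoundary x T' = 0 → T'.card ≤ 2 * (T' \ T.erase e).card := by
    intro T' hT' hT'0
    have heT' : e ∉ T' := fun h => he (hT' h)
    have h1 : T.card ≤ (symmDiff T T').card := by
      refine hmin _ (Finset.mem_filter.2 ⟨Finset.mem_univ _, ?_, ?_, ?_⟩)
      · intro f hf
        rcases Finset.mem_symmDiff.1 hf with h | h
        exacts [hTY h.1, Finset.mem_insert_of_mem (hT' h.1)]
      · exact Finset.mem_symmDiff.2 (Or.inl ⟨heT, heT'⟩)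
      · rw [edgeBoundary_symmDiff, hT0, hT'0, add_zero]
    have h2 : (symmDiff T T').card = (T \ T').card + (T' \ T).card :=
      Finset.card_union_of_disjoint disjoint_sdiff_sdiff
    have h3 := Finset.card_sdiff_add_card_inter T T'
    have h4 := Finset.card_sdiff_add_card_inter T' T
    rw [Finset.inter_comm] at h4
    have h5 : T' \ T.erase e = T' \ T := by
      ext f
      simp only [Finset.mem_sdiff, Finset.mem_erase, not_and]
      constructor
      · rintro ⟨hf, hf'⟩
        exact ⟨hf, hf' (fun h => heT' (h ▸ hf))⟩
      · rintro ⟨hf, hf'⟩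
        exact ⟨hf, fun _ => hf'⟩
    rw [h5]; omega
  obtain ⟨𝒬, h𝒬c, h𝒬h, h𝒬d, h𝒬⟩ := exists_small_obstructions x hx hE (T.erase e) Y h
    (by
      intro T' hT' hT'0 hne
      have h1 := hbig T' hT' hT'0
      have h2 := hne.card_pos
      rcases hg T' hT' hT'0 hne with h | h
      · left; omega
      · right; exact ⟨h, by omega⟩)
  refine ⟨T.erase e, hPY, by rwa [Finset.insert_erase heT], ?_⟩
  have hBr : (0 : ℝ) < B := by exact_mod_cast hBpos
  have hmain := half_pow_le_sum_bernoulliWeight hp0.le hp1 (T.erase e) 𝒬 h h𝒬h h𝒬d (by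
    rw [hp]
    have : (𝒬.card : ℝ) ≤ B := by exact_mod_cast h𝒬c
    push_cast
    rw [mul_one_div, div_le_div_iff₀ (by positivity) (by norm_num)]
    linarith)
  -- The exponent 8 comes from `|P| ≤ 8h` and `p ^ h = 1 / (2B)`.
  have hpow : 1 / ((2 * (2 * B) ^ 8 : ℕ) : ℝ) ≤ p ^ (T.erase e).card / 2 := by
    have h1 : p ^ (h * 8) ≤ p ^ (T.erase e).card :=
      pow_le_pow_of_le_one hp0.le hp1 ((Finset.card_le_card (Finset.erase_subset e T)).trans
        (by omega))
    rw [pow_mul, hp] at h1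
    calc 1 / ((2 * (2 * B) ^ 8 : ℕ) : ℝ) = (1 / ((2 * B : ℕ) : ℝ)) ^ 8 / 2 := by
          push_cast; field_simp
      _ ≤ _ := by linarith
  refine hpow.trans (hmain.trans (Finset.sum_le_sum_of_subset_of_nonneg ?_
    fun S _ _ => bernoulliWeight_nonneg hp0.le hp1 S))
  intro S hS
  simp only [Finset.mem_filter, Finset.mem_univ, true_and] at hS ⊢
  exact ⟨hS.1, h𝒬 S hS.2⟩

/-! ### Cycles of a graph versus sets of zero boundary. -/

/-- The edge set of a cycle is traversed one edge at a time, and the boundaries of the initial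
segments are those of paths. -/
theorem Graph.IsCycleEdgeSet.exists_traversal {E V W : Type*} [DecidableEq E] [DecidableEq W]
    {G : Graph V E} {C : Set E} (hC : G.IsCycleEdgeSet C) (x : E → W × W) (f : V → W)
    (hx : ∀ e a b, G.IsLink e a b → (Pi.single (x e).1 1 + Pi.single (x e).2 1 : W → ZMod 2) =
      Pi.single (f a) 1 + Pi.single (f b) 1) :
    ∃ (n : ℕ) (D : ℕ → Finset E), D 0 = ∅ ∧ (∀ k, (D (k + 1) \ D k).card ≤ 1) ∧
      (∀ k, (D k : Set E) ⊆ C) ∧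
      (∀ k ≤ n, ∃ a b, edgeBoundary x (D k) = Pi.single a 1 + Pi.single b 1) ∧
      edgeBoundary x (D n) = 0 ∧ (D n).Nonempty := by
  obtain ⟨n, v, e, -, he, hl, rfl⟩ := hC
  set D : ℕ → Finset E := fun k => (Finset.univ.filter fun i : Fin (n + 1) => i.val < k).image e
    with hD
  have hsucc : ∀ k ≤ n, D (k + 1) = insert (e (Fin.ofNat (n + 1) k)) (D k) := by
    intro k hk
    rw [hD]
    dsimp only
    rw [← Finset.image_insert]
    congr 1
    ext i
    simp only [Finset.mem_filter, Finset.mem_univ, true_and, Finset.mem_insert, Fin.ext_iff,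
      Fin.val_ofNat, Nat.mod_eq_of_lt (Nat.lt_succ_of_le hk)]
    omega
  have hofNat : ∀ k, Fin.ofNat (n + 1) k + 1 = Fin.ofNat (n + 1) (k + 1) := by
    intro k
    ext
    rw [Fin.val_add]
    simp
  have hnot : ∀ k ≤ n, e (Fin.ofNat (n + 1) k) ∉ D k := by
    intro k hk hmem
    obtain ⟨i, hi, hie⟩ := Finset.mem_image.1 hmem
    rw [he hie, Finset.mem_filter, Fin.val_ofNat, Nat.mod_eq_of_lt (Nat.lt_succ_of_le hk)] at hi
    exact lt_irrefl _ hi.2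
  have hb : ∀ k ≤ n + 1, edgeBoundary x (D k) =
      Pi.single (f (v 0)) 1 + Pi.single (f (v (Fin.ofNat (n + 1) k))) 1 := by
    intro k
    induction k with
    | zero =>
      intro _
      rw [show Fin.ofNat (n + 1) 0 = 0 from rfl, ZMod.two_fun_add_self]
      simp [hD, edgeBoundary]
    | succ k ih =>
      intro hk
      have ih := ih (by omega)
      unfold edgeBoundary at ih ⊢
      rw [hsucc k (by omega), Finset.sum_insert (hnot k (by omega)), ih, hx _ _ _ (hl _),
        hofNat, add_comm (Pi.single (f (v 0)) 1 : W → ZMod 2), add_add_add_comm,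
        ZMod.two_fun_add_self, zero_add, add_comm]
  refine ⟨n + 1, D, by simp [hD], ?_, ?_, fun k hk => ⟨_, _, hb k hk⟩, ?_, ?_⟩
  · intro k
    rcases le_or_gt k n with hk | hk
    · rw [hsucc k hk, Finset.insert_sdiff_of_notMem _ (hnot k hk), Finset.sdiff_self]
      simp
    · have : D (k + 1) = D k := by
        simp only [hD]
        congr 1
        ext i
        simp only [Finset.mem_filter, Finset.mem_univ, true_and]
        omega
      simp [this]
  · intro k a ha
    obtain ⟨i, -, rfl⟩ := Finset.mem_image.1 (Finset.mem_coe.1 ha)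
    exact ⟨i, rfl⟩
  · rw [hb _ le_rfl, show Fin.ofNat (n + 1) (n + 1) = 0 by ext; simp, ZMod.two_fun_add_self]
  · rw [hsucc n le_rfl]; exact Finset.insert_nonempty _ _

/-- A walk that never immediately repeats an edge contains a cycle once it revisits a vertex. -/
theorem Graph.exists_isCycleEdgeSet_of_walk {E V : Type*} {G : Graph V E} (ed : ℕ → E)
    (vt : ℕ → V) (hl : ∀ k, G.IsLink (ed k) (vt k) (vt (k + 1))) (hne : ∀ k, ed (k + 1) ≠ ed k)
    (hrep : ∃ i j, i < j ∧ vt i = vt j) : ∃ C ⊆ Set.range ed, G.IsCycleEdgeSet C := by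
  classical
  have hd : ∃ d i, vt i = vt (i + d + 1) := by
    obtain ⟨i, j, hij, h⟩ := hrep
    exact ⟨j - i - 1, i, by rw [h]; congr 1; omega⟩
  obtain ⟨i, hi⟩ := Nat.find_spec hd
  have hmin := fun d hd' => Nat.find_min hd (m := d) hd'
  set n := Nat.find hd
  have hdist : ∀ k l, k < l → l ≤ n → vt (i + k) ≠ vt (i + l) := by
    intro k l hkl hln h
    refine hmin (l - k - 1) (by omega) ⟨i + k, ?_⟩
    rw [h]; congr 1; omega
  -- With a closest return chosen, a repeated edge would give either a closer return or two equal
  -- consecutive edges.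
  have hedge : ∀ k l, k < l → l ≤ n → ed (i + k) ≠ ed (i + l) := by
    intro k l hkl hln h
    have h1 := hl (i + k)
    rw [h] at h1
    rcases h1.eq_and_eq_or_eq_and_eq (hl (i + l)) with ⟨h2, -⟩ | ⟨-, h2⟩
    · exact hdist k l hkl hln h2
    · rcases (Nat.succ_le_of_lt hkl).lt_or_eq with h3 | h3
      · exact hdist (k + 1) l h3 hln h2
      · refine hne (i + k) ?_
        rw [h, ← h3]; rfl
  refine ⟨_, ?_, n, fun k => vt (i + k.val), fun k => ed (i + k.val), ?_, ?_, ?_, rfl⟩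
  · rintro _ ⟨k, rfl⟩
    exact ⟨_, rfl⟩
  · intro k l h
    rcases lt_trichotomy k l with h' | h' | h'
    · exact absurd h (hdist _ _ h' (Nat.le_of_lt_succ l.2))
    · exact h'
    · exact absurd h.symm (hdist _ _ h' (Nat.le_of_lt_succ k.2))
  · intro k l h
    rcases lt_trichotomy k l with h' | h' | h'
    · exact absurd h (hedge _ _ h' (Nat.le_of_lt_succ l.2))
    · exact h'
    · exact absurd h.symm (hedge _ _ h' (Nat.le_of_lt_succ k.2))
  · intro k
    dsimp only
    rw [Fin.val_add_one]
    split_ifs with hk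
    · have h1 := hl (i + k.val)
      have h2 : k.val = n := by rw [hk]; rfl
      rw [h2, ← hi] at h1
      rw [h2]; exact h1
    · exact hl (i + k.val)

/-- A nonempty set of edges with zero boundary contains a cycle. -/
theorem Graph.exists_isCycleEdgeSet_of_edgeBoundary {E V W : Type*} [DecidableEq W] [Finite W]
    {G : Graph V E} (x : E → W × W) (f : V → W)
    (hx : ∀ e a b, G.IsLink e a b → (Pi.single (x e).1 1 + Pi.single (x e).2 1 : W → ZMod 2) =
      Pi.single (f a) 1 + Pi.single (f b) 1)
    (hf : ∀ e a b e' a' b', G.IsLink e a b → G.IsLink e' a' b' → f a = f a' → a = a')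
    (T : Finset E) (hTG : ∀ e ∈ T, e ∈ G.edgeSet) (hT : edgeBoundary x T = 0)
    (hne : T.Nonempty) : ∃ C ⊆ (T : Set E), G.IsCycleEdgeSet C := by
  classical
  -- Loops have zero boundary, so the parity argument below does not see them.
  by_cases hloop : ∃ e ∈ T, ∃ a, G.IsLink e a a
  · obtain ⟨e, he, a, ha⟩ := hloop
    refine ⟨{e}, by simpa using he, 0, fun _ => a, fun _ => e, ?_, ?_, fun _ => ha, by simp⟩
    · intro i j _; exact Fin.ext (by omega)
    · intro i j _; exact Fin.ext (by omega)
  push Not at hloop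
  -- If no other edge of `T` met `y`, the boundary at `f y` would be 1. Hence a walk can always go
  -- on without repeating its last edge.
  have hstep : ∀ e ∈ T, ∀ a y, G.IsLink e a y → ∃ e' ∈ T, e' ≠ e ∧ ∃ z, G.IsLink e' y z := by
    intro e he a y hay
    by_contra! hcon
    have h1 := congrFun hT (f y)
    unfold edgeBoundary at h1
    rw [Finset.sum_apply, Finset.sum_eq_single_of_mem e he, hx e a y hay] at h1
    · have h2 : f y ≠ f a := fun h => hloop e he a (by
        have := hf _ _ _ _ _ _ hay.symm hay h
        rwa [this] at hay)
      simp [h2] at h1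
    · intro e' he' hne'
      obtain ⟨u, v, huv⟩ := Graph.exists_isLink_of_mem_edgeSet (hTG e' he')
      have hu : f y ≠ f u := fun h => hcon e' he' hne' v (by
        rwa [hf _ _ _ _ _ _ hay.symm huv h])
      have hv : f y ≠ f v := fun h => hcon e' he' hne' u (by
        rw [hf _ _ _ _ _ _ hay.symm huv.symm h]; exact huv.symm)
      rw [hx e' u v huv]
      simp [hu, hv]
  have hnext : ∀ s : {s : E × V × V // s.1 ∈ T ∧ G.IsLink s.1 s.2.1 s.2.2},
      ∃ s' : {s : E × V × V // s.1 ∈ T ∧ G.IsLink s.1 s.2.1 s.2.2},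
        s'.1.1 ≠ s.1.1 ∧ s'.1.2.1 = s.1.2.2 := by
    rintro ⟨⟨e, a, y⟩, he, hl⟩
    obtain ⟨e', he', hne', z, hz⟩ := hstep e he a y hl
    exact ⟨⟨⟨e', y, z⟩, he', hz⟩, hne', rfl⟩
  choose next hnext1 hnext2 using hnext
  obtain ⟨e₀, he₀⟩ := hne
  obtain ⟨a₀, b₀, h₀⟩ := Graph.exists_isLink_of_mem_edgeSet (hTG e₀ he₀)
  let s : ℕ → {s : E × V × V // s.1 ∈ T ∧ G.IsLink s.1 s.2.1 s.2.2} :=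
    fun k => next^[k] ⟨⟨e₀, a₀, b₀⟩, he₀, h₀⟩
  have hs : ∀ k, s (k + 1) = next (s k) := fun k => Function.iterate_succ_apply' _ _ _
  obtain ⟨C, hC, hcyc⟩ := Graph.exists_isCycleEdgeSet_of_walk (G := G) (fun k => (s k).1.1)
    (fun k => (s k).1.2.1)
    (by intro k; rw [hs, hnext2]; exact (s k).2.2)
    (by intro k; rw [hs]; exact hnext1 _)
    (by
      obtain ⟨i, j, hij, h⟩ := Finite.exists_ne_map_eq_of_infinite fun k => f (s k).1.2.1
      have h' := hf _ _ _ _ _ _ (s i).2.2 (s j).2.2 h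
      rcases lt_or_gt_of_ne hij with hlt | hlt
      exacts [⟨i, j, hlt, h'⟩, ⟨j, i, hlt, h'.symm⟩])
  refine ⟨C, hC.trans ?_, hcyc⟩
  rintro _ ⟨k, rfl⟩
  exact (s k).2.1

open scoped Classical in
/-- A graphic matroid is represented by the boundary map of a graph with few vertices. -/
theorem Matroid.IsGraphic.exists_endpoints {E : Type*} [Fintype E] [DecidableEq E]
    {M : Matroid E}
    (hE : M.E = Set.univ) (hM : M.IsGraphic) :
    ∃ x : E → Option (E ⊕ E) × Option (E ⊕ E), HasTraversals x ∧
      ∀ S : Finset E, M.Indep (S : Set E) ↔ EvenFree x S := by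
  obtain ⟨V, G, hG, hind⟩ := hM
  have hedge : ∀ e, e ∈ G.edgeSet := fun e => by rw [← hG, hE]; trivial
  choose a b hab using fun e => Graph.exists_isLink_of_mem_edgeSet (hedge e)
  let g : E ⊕ E → V := Sum.elim a b
  -- `V` may be infinite. A vertex on an edge is named by an edge end located there, and all others
  -- share `none`; this leaves at most `2|E| + 1` names.
  let f : V → Option (E ⊕ E) := fun v => if h : ∃ i, g i = v then some h.choose else none
  have hfinj : ∀ u v, (∃ i, g i = u) → f u = f v → u = v := by
    intro u v hu h
    by_cases hv : ∃ i, g i = v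
    · simp only [f, dif_pos hu, dif_pos hv, Option.some.injEq] at h
      rw [← hu.choose_spec, h, hv.choose_spec]
    · rw [show f u = some _ from dif_pos hu, show f v = none from dif_neg hv] at h
      cases h
  have hrange : ∀ e u v, G.IsLink e u v → ∃ i, g i = u := by
    intro e u v h
    rcases h.left_eq_or_eq (hab e) with h | h
    exacts [⟨Sum.inl e, h.symm⟩, ⟨Sum.inr e, h.symm⟩]
  have hf : ∀ e u v e' u' v', G.IsLink e u v → G.IsLink e' u' v' → f u = f u' → u = u' :=
    fun e u v _ _ _ h _ heq => hfinj _ _ (hrange e u v h) heq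
  let x : E → Option (E ⊕ E) × Option (E ⊕ E) := fun e => (f (a e), f (b e))
  have hx : ∀ e u v, G.IsLink e u v →
      (Pi.single (x e).1 1 + Pi.single (x e).2 1 : Option (E ⊕ E) → ZMod 2) =
        Pi.single (f u) 1 + Pi.single (f v) 1 := by
    intro e u v h
    rcases (hab e).eq_and_eq_or_eq_and_eq h with ⟨h1, h2⟩ | ⟨h1, h2⟩
    · simp only [x, h1, h2]
    · simp only [x, h1, h2]; rw [add_comm]
  have hiff : ∀ S : Finset E, M.Indep (S : Set E) ↔ EvenFree x S := by
    intro S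
    rw [hind S (by rw [hE]; exact Set.subset_univ _)]
    constructor
    · intro h T hTS hT
      by_contra hne
      obtain ⟨C, hCT, hC⟩ := Graph.exists_isCycleEdgeSet_of_edgeBoundary x f hx hf T
        (fun e _ => hedge e) hT (Finset.nonempty_iff_ne_empty.2 hne)
      exact h ⟨C, hCT.trans (by exact_mod_cast hTS), hC⟩
    · rintro h ⟨C, hCS, hC⟩
      obtain ⟨n, D, -, -, hDC, -, hDn, hne⟩ := hC.exists_traversal x f hx
      exact hne.ne_empty (h _ (by exact_mod_cast (hDC n).trans hCS) hDn)
  refine ⟨x, fun S hS => ?_, hiff⟩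
  rw [← hiff, hind S (by rw [hE]; exact Set.subset_univ _), not_not] at hS
  obtain ⟨C, hCS, hC⟩ := hS
  obtain ⟨n, D, h0, h1, hDC, h2⟩ := hC.exists_traversal x f hx
  exact ⟨n, D, h0, h1, fun k => by exact_mod_cast (hDC k).trans hCS, h2⟩

/-! ### Polynomial families of samples that serve all graphs. -/

/-- The number of sets sampled in each round. -/
def sampleBound (m : ℕ) : ℕ :=
  2 * (2 * (2 * m + 1) ^ 2) ^ 8 * (m * (2 * m + 1) ^ 2 + 2 * m + 1)

open scoped Classical in
/-- A polynomial number of sets suffices to detect, in every graph without cycles of length at most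
`4 * h`, all edges that close a cycle of length at most `8 * h` with a given set of edges. -/
theorem exists_detecting_family (m h : ℕ) (hh : h ≠ 0) :
    ∃ F : Finset (Finset (Fin m)), F.card ≤ sampleBound m ∧
      ∀ x : Fin m → Option (Fin m ⊕ Fin m) × Option (Fin m ⊕ Fin m), HasTraversals x →
        ∀ (Y : Finset (Fin m)) (e : Fin m), e ∉ Y →
        (∀ T ⊆ Y, edgeBoundary x T = 0 → T.Nonempty → 4 * h < T.card ∨ h = 1) →
        (∃ T ⊆ insert e Y, e ∈ T ∧ edgeBoundary x T = 0 ∧ T.card ≤ 8 * h) →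
        ∃ S ∈ F, EvenFree x (S ∩ Y) ∧ ¬ EvenFree x (insert e (S ∩ Y)) := by
  set V := Option (Fin m ⊕ Fin m) with hV
  have hB : Fintype.card (V × V) = (2 * m + 1) ^ 2 := by
    simp [hV, sq]; ring
  have hBpos : 0 < (2 * m + 1) ^ 2 := by positivity
  set q : ℝ := 1 / (2 * Fintype.card (V × V) : ℕ) with hq
  have hq0 : 0 < q := by rw [hq, hB]; positivity
  have hq1 : q ≤ 1 := by
    rw [hq, div_le_one (by rw [hB]; positivity), Nat.one_le_cast, hB]
    omega
  set p : ℝ := q ^ ((h : ℝ)⁻¹) with hp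
  have hp0 : 0 < p := Real.rpow_pos_of_pos hq0 _
  have hp1 : p ≤ 1 := Real.rpow_le_one hq0.le hq1 (by positivity)
  have hph : p ^ h = q := Real.rpow_inv_natCast_pow hq0.le hh
  -- The exponent bounds the number of triples: `((2m+1)²) ^ m` endpoint maps and `4 ^ m` pairs `(Y,
  -- P)`.
  obtain ⟨F, hF, hhit⟩ := exists_hitting_finset
    (X := (Fin m → V × V) × Finset (Fin m) × Finset (Fin m)) (bernoulliWeight p)
    (bernoulliWeight_nonneg hp0.le hp1) (sum_bernoulliWeight p)
    (fun i S => i.2.2 ⊆ S ∧ EvenFree i.1 (S ∩ i.2.1))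
    (2 * (2 * Fintype.card (V × V)) ^ 8) (m * (2 * m + 1) ^ 2 + 2 * m + 1)
    (by rw [hB]; positivity)
    (by
      rw [Fintype.card_prod, Fintype.card_prod, Fintype.card_fun, Fintype.card_finset,
        Fintype.card_fin, hB]
      calc ((2 * m + 1) ^ 2) ^ m * (2 ^ m * 2 ^ m)
          ≤ (2 ^ ((2 * m + 1) ^ 2)) ^ m * (2 ^ m * 2 ^ m) :=
            Nat.mul_le_mul_right _ (Nat.pow_le_pow_left Nat.lt_two_pow_self.le _)
        _ = 2 ^ (m * (2 * m + 1) ^ 2 + 2 * m) := by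
            rw [← pow_mul, ← pow_add, ← pow_add]; congr 1; ring
        _ < _ := Nat.pow_lt_pow_right (by norm_num) (by omega))
  refine ⟨F, by rwa [hB] at hF, fun x hx Y e he hg hT => ?_⟩
  obtain ⟨P, hPY, hP0, hP⟩ := exists_likely_spanning_path x hx
    (by rw [hB, Fintype.card_fin]; nlinarith) Y e he h hg hT p hp0 hp1 hph
  obtain ⟨S, hS, hPS, hind⟩ := hhit (x, Y, P) (by convert hP)
  refine ⟨S, hS, hind, fun hcon => Finset.insert_ne_empty e P ?_⟩
  exact hcon _ (Finset.insert_subset_insert e (Finset.subset_inter hPS hPY)) hP0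

/-! ### Deletion of spanned elements and minimum-weight bases. -/

/-- The elements of `A` that precede `e` in the order given by `ρ`. -/
def elementsBefore {E : Type*} (ρ : E → ℕ) (A : Finset E) (e : E) : Finset E :=
  A.filter fun f => ρ f < ρ e

theorem mem_elementsBefore {E : Type*} {ρ : E → ℕ} {A : Finset E} {e f : E} :
    f ∈ elementsBefore ρ A e ↔ f ∈ A ∧ ρ f < ρ e :=
  Finset.mem_filter

/-- Removing elements that are spanned by earlier ones keeps all removed elements spanned by
earlier remaining ones. -/
theorem Matroid.mem_closure_elementsBefore {E : Type*} {M : Matroid E} (hE : M.E = Set.univ)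
    (ρ : E → ℕ) (A A' : Finset E)
    (h : ∀ e ∉ A', e ∈ M.closure (elementsBefore ρ A e : Set E)) :
    ∀ e ∉ A', e ∈ M.closure (elementsBefore ρ A' e : Set E) := by
  suffices H : ∀ n e, ρ e = n → e ∉ A' → e ∈ M.closure (elementsBefore ρ A' e : Set E) from
    fun e => H _ e rfl
  intro n
  induction n using Nat.strong_induction_on with
  | _ n ih =>
    intro e hn he
    -- A spanning element that is itself deleted is replaced, by induction, with the survivors
    -- before it.
    refine M.closure_subset_closure_of_subset_closure ?_ (h e he)
    intro f hf
    obtain ⟨-, hfe⟩ := mem_elementsBefore.1 (Finset.mem_coe.1 hf)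
    by_cases hfA : f ∈ A'
    · exact M.mem_closure_of_mem' (mem_elementsBefore.2 ⟨hfA, hfe⟩) (by rw [hE]; trivial)
    · refine M.closure_subset_closure ?_ (ih _ (hn ▸ hfe) f rfl hfA)
      intro g hg
      obtain ⟨hg1, hg2⟩ := mem_elementsBefore.1 (Finset.mem_coe.1 hg)
      exact mem_elementsBefore.2 ⟨hg1, hg2.trans hfe⟩

/-- An independent set such that every other element is spanned by earlier members of the set is
a minimum-weight base. -/
theorem Matroid.isMinWeightBase_of_mem_closure_elementsBefore {E : Type*} [Finite E]
    {M : Matroid E} (hE : M.E = Set.univ) (w : E → ℝ) (ρ : E → ℕ)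
    (hρ : ∀ e f, ρ e < ρ f → w e ≤ w f) (F : Finset E) (hF : M.Indep (F : Set E))
    (hcl : ∀ e ∉ F, e ∈ M.closure (elementsBefore ρ F e : Set E)) :
    M.IsMinWeightBase w F := by
  classical
  have hbase : M.IsBase (F : Set E) := by
    refine hF.isBase_of_ground_subset_closure fun e _ => ?_
    by_cases he : e ∈ F
    · exact M.mem_closure_of_mem' he (by rw [hE]; trivial)
    · exact M.closure_subset_closure (Finset.coe_subset.2 (Finset.filter_subset _ _)) (hcl e he)
  refine ⟨hbase, ?_⟩
  suffices H : ∀ n, ∀ F' : Finset E, (F' \ F).card = n → M.IsBase (F' : Set E) →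
      ∑ e ∈ F, w e ≤ ∑ e ∈ F', w e from fun F' => H _ F' rfl
  intro n
  induction n with
  | zero =>
    intro F' hn hF'
    rw [Finset.card_eq_zero, Finset.sdiff_eq_empty_iff_subset] at hn
    rw [Finset.coe_injective (hF'.eq_of_subset_isBase hbase (Finset.coe_subset.2 hn))]
  | succ n ih =>
    intro F' hn hF'
    obtain ⟨e, he⟩ : (F' \ F).Nonempty := Finset.card_pos.1 (by omega)
    obtain ⟨heF', heF⟩ := Finset.mem_sdiff.1 he
    -- Otherwise `F' \ {e}` would span `e`. Exchanging `e` for the earlier `f` does not raise the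
    -- weight and brings `F'` closer to `F`.
    obtain ⟨f, hf, hfcl⟩ : ∃ f ∈ elementsBefore ρ F e, f ∉ M.closure ((F' : Set E) \ {e}) := by
      by_contra! hcon
      exact hF'.indep.notMem_closure_sdiff_of_mem heF'
        (M.closure_subset_closure_of_subset_closure (fun f hf => hcon f hf) (hcl e heF))
    obtain ⟨hfF, hfe⟩ := mem_elementsBefore.1 hf
    have hne : f ≠ e := fun h => lt_irrefl _ (h ▸ hfe)
    have hnot : f ∉ F'.erase e := fun h => hfcl (M.mem_closure_of_mem'
      ⟨Finset.mem_of_mem_erase h, hne⟩ (by rw [hE]; trivial))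
    have hb := hF'.exchange_base_of_notMem_closure heF' hfcl (by rw [hE]; trivial)
    have h1 := ih (insert f (F'.erase e)) (by
      rw [Finset.insert_sdiff_of_mem _ hfF, Finset.erase_sdiff_comm, Finset.card_erase_of_mem he,
        hn, Nat.add_sub_cancel]) (by push_cast; exact hb)
    rw [Finset.sum_insert hnot] at h1
    have h2 := Finset.add_sum_erase F' w heF'
    have h3 := hρ f e hfe
    linarith

/-! ### The parallel algorithm and its correctness. -/

namespace ParallelTree

/-- A round of queries indexed by an arbitrary finite type. -/
noncomputable def ask {m : ℕ} {ι : Type} [Fintype ι] (B : ι → Finset (Fin m))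
    (next : (ι → Bool) → ParallelTree m) : ParallelTree m :=
  query (Fintype.card ι) (fun i => B ((Fintype.equivFin ι).symm i))
    fun a => next fun i => a (Fintype.equivFin ι i)

section

variable {m : ℕ} {ι : Type} [Fintype ι] (O : Finset (Fin m) → Bool) (B : ι → Finset (Fin m))
  (next : (ι → Bool) → ParallelTree m)

theorem output_ask : (ask B next).output O = (next fun i => O (B i)).output O := by
  simp [ask, output]

theorem rounds_ask : (ask B next).rounds O = (next fun i => O (B i)).rounds O + 1 := by
  simp [ask, rounds]

theorem maxQueries_ask : (ask B next).maxQueries O =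
    max (Fintype.card ι) ((next fun i => O (B i)).maxQueries O) := by
  simp [ask, maxQueries]

end

open scoped Classical in
/-- The deletion algorithm: in each round, delete the elements that are found to be spanned by an
independent subset, taken from a fixed family, of the earlier remaining elements. -/
noncomputable def sweep {m : ℕ} (F : ℕ → Finset (Finset (Fin m))) (ρ : Fin m → ℕ) :
    ℕ → ℕ → Finset (Fin m) → ParallelTree m
  | 0, _, A => leaf A
  | k + 1, i, A =>
    ask (ι := {S // S ∈ F i} × Fin m × Bool)
      -- The Boolean says whether `e` is added to the sample of earlier elements; `e` is deleted
      -- when adding it destroys independence.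
      (fun t => if t.2.2 then insert t.2.1 (t.1.1 ∩ elementsBefore ρ A t.2.1)
        else t.1.1 ∩ elementsBefore ρ A t.2.1)
      fun ans => sweep F ρ k (i + 1)
        (A.filter fun e => ¬ ∃ S, ans (S, e, false) = true ∧ ans (S, e, true) = false)

theorem rounds_sweep {m : ℕ} (F : ℕ → Finset (Finset (Fin m))) (ρ : Fin m → ℕ)
    (O : Finset (Fin m) → Bool) (k i : ℕ) (A : Finset (Fin m)) :
    (sweep F ρ k i A).rounds O = k := by
  induction k generalizing i A with
  | zero => rfl
  | succ k ih => rw [sweep, rounds_ask, ih]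

theorem maxQueries_sweep_le {m : ℕ} (F : ℕ → Finset (Finset (Fin m))) (N : ℕ)
    (hF : ∀ i, (F i).card ≤ N) (ρ : Fin m → ℕ) (O : Finset (Fin m) → Bool) (k i : ℕ)
    (A : Finset (Fin m)) : (sweep F ρ k i A).maxQueries O ≤ N * (m * 2) := by
  induction k generalizing i A with
  | zero => exact Nat.zero_le _
  | succ k ih =>
    rw [sweep, maxQueries_ask]
    refine max_le ?_ (ih _ _)
    rw [Fintype.card_prod, Fintype.card_prod, Fintype.card_coe, Fintype.card_fin,
      Fintype.card_bool]
    exact Nat.mul_le_mul_right _ (hF i)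

/-- The families of queries used in the successive rounds. -/
noncomputable def detectingFamily (m i : ℕ) : Finset (Finset (Fin m)) :=
  (exists_detecting_family m (2 ^ i) (by positivity)).choose

/-- The sweep deletes only elements spanned by earlier remaining ones, and doubles the girth in
each round. -/
theorem output_sweep_spec {m : ℕ} {M : Matroid (Fin m)} (hE : M.E = Set.univ)
    (x : Fin m → Option (Fin m ⊕ Fin m) × Option (Fin m ⊕ Fin m)) (hx : HasTraversals x)
    (hM : ∀ S : Finset (Fin m), M.Indep (S : Set (Fin m)) ↔ EvenFree x S)
    (ρ : Fin m → ℕ) (hρ : Function.Injective ρ) (k i : ℕ) (A : Finset (Fin m))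
    (hspan : ∀ e ∉ A, e ∈ M.closure (elementsBefore ρ A e : Set (Fin m)))
    (hgirth : ∀ T ⊆ A, edgeBoundary x T = 0 → T.Nonempty → 4 * 2 ^ i < T.card ∨ 2 ^ i = 1) :
    (∀ e ∉ (sweep (detectingFamily m) ρ k i A).output M.indepOracle,
      e ∈ M.closure
        (elementsBefore ρ ((sweep (detectingFamily m) ρ k i A).output M.indepOracle) e)) ∧
    ∀ T ⊆ (sweep (detectingFamily m) ρ k i A).output M.indepOracle, edgeBoundary x T = 0 →
      T.Nonempty → 4 * 2 ^ (i + k) < T.card ∨ 2 ^ (i + k) = 1 := by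
  classical
  induction k generalizing i A with
  | zero => exact ⟨hspan, hgirth⟩
  | succ k ih =>
    rw [sweep, output_ask, show i + (k + 1) = i + 1 + k by ring]
    refine ih (i + 1) _ ?_ ?_
    · refine M.mem_closure_elementsBefore hE ρ A _ fun e he => ?_
      by_cases heA : e ∈ A
      · simp only [Finset.mem_filter, heA, true_and, not_not, Matroid.indepOracle,
          decide_eq_true_eq, decide_eq_false_iff_not, if_true, Bool.false_eq_true, if_false] at he
        -- The two answers alone certify that `e` is spanned; the choice of the family plays no role
        -- in soundness.
        obtain ⟨S, hS, hSe⟩ := he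
        rw [Finset.coe_insert, hS.insert_indep_iff, hE] at hSe
        push Not at hSe
        refine M.closure_subset_closure
          (Finset.coe_subset.2 (Finset.inter_subset_right (s₁ := S.1))) ?_
        by_contra hcon
        exact hSe.1 ⟨trivial, hcon⟩
      · exact hspan e heA
    · intro T hT hT0 hne
      left
      by_contra! hle
      -- The rest of a surviving short `T` precedes its last element `e`, so this round would have
      -- deleted `e`.
      obtain ⟨e, he, hmax⟩ := Finset.exists_max_image T ρ hne
      have hTA : T ⊆ A := hT.trans (Finset.filter_subset _ _)
      obtain ⟨S, hS, h1, h2⟩ := (exists_detecting_family m (2 ^ i) (by positivity)).choose_spec.2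
        x hx (elementsBefore ρ A e) e (fun h => lt_irrefl _ (mem_elementsBefore.1 h).2)
        (fun T' hT' => hgirth T' (hT'.trans (Finset.filter_subset _ _)))
        ⟨T, fun f hf => by
          rcases eq_or_ne f e with h | h
          · exact h ▸ Finset.mem_insert_self _ _
          · exact Finset.mem_insert_of_mem (mem_elementsBefore.2
              ⟨hTA hf, lt_of_le_of_ne (hmax f hf) fun h' => h (hρ h')⟩),
          he, hT0, by rw [pow_succ] at hle; omega⟩
      refine (Finset.mem_filter.1 (hT he)).2 ⟨⟨S, hS⟩, ?_, ?_⟩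
      · simp only [Matroid.indepOracle, decide_eq_true_eq, Bool.false_eq_true, if_false, hM]
        exact h1
      · simp only [Matroid.indepOracle, decide_eq_false_iff_not, if_true, hM]
        exact h2

/-- The algorithm for a minimum-weight base: the elements are ordered by weight. -/
noncomputable def minBase (m : ℕ) (w : Fin m → ℝ) : ParallelTree m :=
  sweep (detectingFamily m) (fun e => ((Tuple.sort w).symm e).val) (Nat.log 2 m + 1) 0 Finset.univ

theorem rounds_minBase (m : ℕ) (w : Fin m → ℝ) (O : Finset (Fin m) → Bool) :
    (minBase m w).rounds O = Nat.log 2 m + 1 :=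
  rounds_sweep _ _ _ _ _ _

theorem maxQueries_minBase_le (m : ℕ) (w : Fin m → ℝ) (O : Finset (Fin m) → Bool) :
    (minBase m w).maxQueries O ≤ sampleBound m * (m * 2) :=
  maxQueries_sweep_le _ _
    (fun i => (exists_detecting_family m (2 ^ i) (by positivity)).choose_spec.1) _ _ _ _ _

theorem isMinWeightBase_output_minBase {m : ℕ} (w : Fin m → ℝ) {M : Matroid (Fin m)}
    (hE : M.E = Set.univ) (hM : M.IsGraphic) :
    M.IsMinWeightBase w ((minBase m w).output M.indepOracle) := by
  obtain ⟨x, hx, hind⟩ := hM.exists_endpoints hE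
  obtain ⟨hspan, hgirth⟩ := output_sweep_spec hE x hx hind
    (fun e => ((Tuple.sort w).symm e).val)
    (Fin.val_injective.comp (Tuple.sort w).symm.injective) (Nat.log 2 m + 1) 0 Finset.univ
    -- Initially nothing is deleted, and `2 ^ 0 = 1` makes the girth condition vacuous.
    (fun e he => absurd (Finset.mem_univ e) he) (fun _ _ _ _ => Or.inr rfl)
  refine M.isMinWeightBase_of_mem_closure_elementsBefore hE w _ ?_ _ ?_ hspan
  · intro e f h
    simpa using Tuple.monotone_sort w (Fin.le_def.2 h.le)
  · rw [hind]
    intro T hT hT0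
    by_contra hne
    -- The final girth bound exceeds `m`, so no cycle fits.
    have h1 := hgirth T hT hT0 (Finset.nonempty_iff_ne_empty.2 hne)
    have h2 : m < 2 ^ (Nat.log 2 m + 1) := Nat.lt_pow_succ_log_self (by norm_num) m
    have h3 := T.card_le_univ
    rw [Fintype.card_fin] at h3
    have h4 : 1 < 2 ^ (Nat.log 2 m + 1) := Nat.one_lt_two_pow (by omega)
    rw [zero_add] at h1
    omega

end ParallelTree

/-! ### Logarithmic round bound and conclusion. -/

theorem isBigO_natLog_add_one :
    Asymptotics.IsBigO Filter.atTop (fun m : ℕ => ((Nat.log 2 m + 1 : ℕ) : ℝ))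
      (fun m : ℕ => Real.log (m : ℝ)) := by
  refine Asymptotics.IsBigO.of_bound (1 / Real.log 2 + 1) ?_
  -- From 3 on, `log m ≥ 1` absorbs the additive constant.
  filter_upwards [Filter.eventually_ge_atTop 3] with m hm
  have h1 : 1 ≤ Real.log m := by
    rw [Real.le_log_iff_exp_le (by positivity)]
    have : (3 : ℝ) ≤ m := by exact_mod_cast hm
    linarith [Real.exp_one_lt_d9]
  have h2 : (Nat.log 2 m : ℝ) ≤ Real.logb 2 m := by exact_mod_cast Real.natLog_le_logb m 2
  rw [Real.logb] at h2
  rw [Real.norm_of_nonneg (Nat.cast_nonneg _), Real.norm_of_nonneg (by linarith)]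
  push_cast
  calc (Nat.log 2 m : ℝ) + 1 ≤ Real.log m / Real.log 2 + Real.log m := add_le_add h2 h1
    _ = _ := by ring

open Polynomial in
theorem mainTheorem7 :
    ∃ (R : ℕ → ℕ) (p : Polynomial ℕ)
      (Amin Amax : (m : ℕ) → (Fin m → ℝ) → ParallelTree m),
      Asymptotics.IsBigO Filter.atTop (fun m : ℕ => (R m : ℝ)) (fun m : ℕ => Real.log (m : ℝ)) ∧
      ∀ (m : ℕ) (w : Fin m → ℝ) (M : Matroid (Fin m)), M.E = Set.univ → M.IsGraphic →
        ((Amin m w).rounds M.indepOracle ≤ R m ∧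
          (Amin m w).maxQueries M.indepOracle ≤ p.eval m ∧
          M.IsMinWeightBase w ((Amin m w).output M.indepOracle)) ∧
        ((Amax m w).rounds M.indepOracle ≤ R m ∧
          (Amax m w).maxQueries M.indepOracle ≤ p.eval m ∧
          M.IsMaxWeightBase w ((Amax m w).output M.indepOracle)) := by
  have hp : ∀ m : ℕ, sampleBound m * (m * 2) =
      (2 * (2 * (2 * X + 1) ^ 2) ^ 8 * (X * (2 * X + 1) ^ 2 + 2 * X + 1) * (X * 2) : ℕ[X]).eval m := by
    intro m
    simp [sampleBound]
  refine ⟨fun m => Nat.log 2 m + 1, _, ParallelTree.minBase,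
    fun m w => ParallelTree.minBase m (-w), isBigO_natLog_add_one, fun m w M hE hM =>
    ⟨⟨(ParallelTree.rounds_minBase m w _).le,
      (ParallelTree.maxQueries_minBase_le m w _).trans (hp m).le,
      ParallelTree.isMinWeightBase_output_minBase w hE hM⟩,
    (ParallelTree.rounds_minBase m (-w) _).le,
      (ParallelTree.maxQueries_minBase_le m (-w) _).trans (hp m).le, ?_⟩⟩
  obtain ⟨h1, h2⟩ := ParallelTree.isMinWeightBase_output_minBase (-w) hE hM
  refine ⟨h1, fun F' hF' => ?_⟩
  have h3 := h2 F' hF'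
  simp only [Pi.neg_apply, Finset.sum_neg_distrib, neg_le_neg_iff] at h3
  exact h3
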